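/- **Setting.** Let $\mathbb K$ be a countable set and $\Sigma$ a set. For a set $C$, the name algebra $\mathcal N[C]$ consists of the terms generated from atoms $c\in C$ by the operations $u\mapsto u.l$, $u\mapsto u.r$, $(u,v)\mapsto u\vee v$, modulo the equations $(u\vee v).l=u$, $(u\vee v).r=v$, $u.l\vee u.r=u$; for a word $t\in\{l,r\}^*$, $u.t$ denotes the iterated application. Put $\mathcal V=\mathcal N[\mathbb K\sqcup -\mathbb K]$, where $-\mathbb K=\{-c: c\in\mathbb K\}$ is a disjoint copy of $\mathbb K$. For $V\subseteq\mathcal V$ let $\mathcal N[V]\subseteq\mathcal V$ be the closure of $V$ under $.l$, $.r$, $\vee$, and write $V\mathrel{\hat=}V'$ if $\mathcal N[V]=\mathcal N[V']$. A graph is a finite set $G\subseteq\Sigma\times\mathcal V$ such that $(\sigma,v),(\sigma',v')\in G$ and $v.t=v'.t'$ with $t,t'\in\{l,r\}^*$ imply $\sigma=\sigma'$, $v=v'$ and $t=t'$; its support is $V(G)=\{v:(\sigma,v)\in G\}$. Let $\mathcal G$ be the set of graphs and $\mathcal H=\ell^2(\mathcal G)$, with canonical basis $(|G\rangle)_{G\in\mathcal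 G}$. An operator $A$ on $\mathcal H$ is name-preserving if $\langle H|A|G\rangle=0$ whenever $V(G)\mathrel{\hat{\neq}}V(H)$. A restriction is a map $\chi:\mathcal G\to\mathcal G$, $G\mapsto G_\chi\subseteq G$, such that $G_\chi\subseteq H\subseteq G$ implies $H_\chi=G_\chi$. Write $G_{\overline\chi}=G\setminus G_\chi$, $G_{\zeta\chi}=(G_\zeta)_\chi$ and $G_{\zeta\overline\chi}=(G_\zeta)_{\overline\chi}$. Put $|H\rangle\otimes_\chi|H'\rangle=|G\rangle$ if $H=G_\chi$ and $H'=G_{\overline\chi}$ for a (then unique) graph $G$, and $|H\rangle\otimes_\chi|H'\rangle=0$ otherwise. The partial trace $\rho\mapsto\rho_{|\chi}$ is the linear extension to trace class operators $\rho$ of $$|G\rangle\langle H|\;\mapsto\;\langle H_{\overline\chi}|G_{\overline\chi}\rangle\,|G_\chi\rangle\langle H_\chi| ,$$ and $((\cdot)_{|\chi}\otimes_\zeta I)$ is the linear extension to trace class operators of $$|G\rangle\langle H|\;\mapsto\;\langle H_{\zeta\overline\chi}|G_{\zeta\overline\chi}\rangle\,\bigl(|G_{\zeta\chi}\rangle\otimes_\zeta|G_{\overline\zeta}\rangle\bigr)\bigl(|H_{\zeta\chi}\rangle\otimes_\zeta|H_{\overline\zeta}\rangle\bigr)^\dagger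 .$$ Here the linear extension of $|G\rangle\langle H|\mapsto\Phi(G,H)$ sends $\rho$ to the bounded operator $T$ with $\langle X|T|Y\rangle=\sum_{G,H\in\mathcal G}\langle G|\rho|H\rangle\,\langle X|\Phi(G,H)|Y\rangle$ for all $X,Y\in\mathcal G$. **Statement.** Let $\chi$ be a restriction. 1. For every restriction $\zeta$, the map $((\cdot)_{|\chi}\otimes_\zeta I)$ is well defined on trace class operators (the above sums converge unconditionally and define a bounded operator), takes trace class operators to trace class operators, maps positive (i.e. positive semidefinite) ones to positive ones, and maps name-preserving ones to name-preserving ones. 2. If moreover $|G_{\zeta\chi}\rangle\otimes_\zeta|G_{\overline\zeta}\rangle\neq0$ for all $G\in\mathcal G$, then the map $((\cdot)_{|\chi}\otimes_\zeta I)$ is trace-preserving. 3. In particular, the partial trace $\rho\mapsto\rho_{|\chi}$ is well defined from trace class operators to trace class operators, positivity-preserving, name-preservation-preserving and trace-preserving. It is completely positive: it remains positivity-preserving when tensored with the identity, both in the sense of $\otimes_\zeta$ for every restriction $\zeta$ (item 1) and in the sense that for every $n$ and every $n\times n$ matrix $(\rho_{ij})$ of trace class operators that is positive as an operator on $\mathcal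 H^{n}$, the matrix $((\rho_{ij})_{|\chi})$ is positive on $\mathcal H^n$. -/

import Mathlib

open scoped ComplexOrder

noncomputable section

namespace QNet

/-! ### The name algebra -/

/-- Terms over the atoms `C`.  For a word `t = s₁ … sₙ` in `{l, r}`, the term `u.t` is the iterated
`(… (u.s₁) …).sₙ`, so only the two one-letter projections are constructors. -/
inductive NameTerm (C : Type*) : Type _
  | atom (c : C) : NameTerm C
  | left (u : NameTerm C) : NameTerm C
  | right (u : NameTerm C) : NameTerm C
  | join (u v : NameTerm C) : NameTerm C

/-- The equality theory: the congruence generated by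
`(u ∨ v).l = u`, `(u ∨ v).r = v`, `u.l ∨ u.r = u`. -/
inductive NameEq {C : Type*} : NameTerm C → NameTerm C → Prop
  | refl (u) : NameEq u u
  | symm {u v} : NameEq u v → NameEq v u
  | trans {u v w} : NameEq u v → NameEq v w → NameEq u w
  | left {u v} : NameEq u v → NameEq u.left v.left
  | right {u v} : NameEq u v → NameEq u.right v.right
  | join {u u' v v'} : NameEq u u' → NameEq v v' → NameEq (u.join v) (u'.join v')
  | join_left (u v : NameTerm C) : NameEq ((NameTerm.join u v).left) u
  | join_right (u v : NameTerm C) : NameEq ((NameTerm.join u v).right) v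
  | left_join_right (u : NameTerm C) : NameEq (NameTerm.join u.left u.right) u

/-- Provable equality of terms as a setoid. -/
instance nameSetoid (C : Type*) : Setoid (NameTerm C) where
  r := NameEq
  iseqv := ⟨NameEq.refl, NameEq.symm, NameEq.trans⟩

/-- The name algebra `𝒩[C]`. -/
def Name (C : Type*) : Type _ := Quotient (nameSetoid C)

namespace Name

variable {C : Type*}

/-- An atom as a name. -/
def atom (c : C) : Name C := Quotient.mk (nameSetoid C) (.atom c)

/-- `u.l` -/
def left : Name C → Name C := Quotient.map NameTerm.left fun _ _ h => NameEq.left h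

/-- `u.r` -/
def right : Name C → Name C := Quotient.map NameTerm.right fun _ _ h => NameEq.right h

/-- `u ∨ v` -/
def join : Name C → Name C → Name C :=
  Quotient.map₂ NameTerm.join fun _ _ h _ _ h' => NameEq.join h h'

/-- `u.t` for a word `t` (`false` is the letter `l`, `true` is the letter `r`). -/
def proj (u : Name C) (t : List Bool) : Name C :=
  t.foldl (fun w s => if s then w.right else w.left) u

/-- `Generated V u` says that `u ∈ 𝒩[V]`: `u` is obtained from elements of `V` by
the operations `.l`, `.r` and `∨`. -/
inductive Generated (V : Set (Name C)) : Name C → Prop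
  | of {u} : u ∈ V → Generated V u
  | left {u} : Generated V u → Generated V u.left
  | right {u} : Generated V u → Generated V u.right
  | join {u v} : Generated V u → Generated V v → Generated V (u.join v)

/-- `𝒩[V] = 𝒩[V']`. -/
def Corresponds (V V' : Set (Name C)) : Prop := {u | Generated V u} = {u | Generated V' u}

end Name

/-- `𝒱 = 𝒩[𝕂 ∪ -𝕂]`; `Sum.inl c` is the atom `c`, `Sum.inr c` is the atom `-c`. -/
abbrev Vertex (K : Type*) : Type _ := Name (K ⊕ K)

/-! ### Graphs -/

/-- A graph: a finite set of systems `(σ, v)` (internal state, vertex) with disjoint names. -/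
@[ext]
structure Graph (S K : Type*) where
  systems : Set (S × Vertex K)
  finite : systems.Finite
  wellNamed : ∀ x ∈ systems, ∀ y ∈ systems, ∀ t t' : List Bool,
    x.2.proj t = y.2.proj t' → x = y ∧ t = t'

namespace Graph

variable {S K : Type*}

instance : HasSubset (Graph S K) := ⟨fun G H => G.systems ⊆ H.systems⟩

instance : SDiff (Graph S K) :=
  ⟨fun G H =>
    { systems := G.systems \ H.systems
      finite := G.finite.subset Set.sdiff_subset
      wellNamed := fun x hx y hy => G.wellNamed x hx.1 y hy.1 }⟩

/-- The support `V(G)`. -/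
def support (G : Graph S K) : Set (Vertex K) := Prod.snd '' G.systems

end Graph

/-- A restriction `G ↦ G_χ`. -/
structure Restriction (S K : Type*) where
  toFun : Graph S K → Graph S K
  subset : ∀ G, toFun G ⊆ G
  stable : ∀ G H, toFun G ⊆ H → H ⊆ G → toFun H = toFun G

namespace Restriction

variable {S K : Type*}

instance : CoeFun (Restriction S K) (fun _ => Graph S K → Graph S K) := ⟨Restriction.toFun⟩

/-- The complement `G ∖ G_χ`. -/
def compl (χ : Restriction S K) (G : Graph S K) : Graph S K := G \ χ G

end Restriction

/-! ### The Hilbert space of graphs and its operators -/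

/-- The Hilbert space whose canonical orthonormal basis is labelled by the graphs. -/
abbrev HSpace (S K : Type*) : Type _ := lp (fun _ : Graph S K => ℂ) 2

/-- Bounded operators. -/
abbrev Op (S K : Type*) : Type _ := HSpace S K →L[ℂ] HSpace S K

section

variable {S K : Type*}

open Classical in
/-- The basis vector `|G⟩`. -/
def ket (G : Graph S K) : HSpace S K := lp.single 2 G (1 : ℂ)

/-- The matrix entry `⟨G|T|H⟩`. -/
def entry (T : Op S K) (G H : Graph S K) : ℂ := inner ℂ (ket G) (T (ket H))

/-- The operator `|ψ⟩⟨φ|`. -/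
def ketbra (ψ φ : HSpace S K) : Op S K := InnerProductSpace.rankOne ℂ ψ φ

/-- Trace class operators: sums `∑ₙ |aₙ⟩⟨bₙ|` with `∑ₙ ‖aₙ‖ ‖bₙ‖ < ∞` (on a Hilbert space these are
exactly the operators `T` for which `|T|` has finite trace). -/
def IsTraceClass (T : Op S K) : Prop :=
  ∃ a b : ℕ → HSpace S K, Summable (fun n => ‖a n‖ * ‖b n‖) ∧
    HasSum (fun n => ketbra (a n) (b n)) T

/-- The full trace. -/
def trace (T : Op S K) : ℂ := ∑' G : Graph S K, entry T G G

/-- Name-preservation of an operator. -/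
def NamePreserving (T : Op S K) : Prop :=
  ∀ G H : Graph S K, ¬ Name.Corresponds G.support H.support → entry T H G = 0

/-! ### Linear extension from matrix units -/

/-- `T = ∑_{G,H} ρ_{GH} Φ(|G⟩⟨H|)`, entry by entry, with unconditional convergence of each entry;
here `Φ G H` is the prescribed image of `|G⟩⟨H|` and `ρ_{GH} = ⟨G|ρ|H⟩`. -/
def IsLinearExtension (Φ : Graph S K → Graph S K → Op S K) (ρ T : Op S K) : Prop :=
  ∀ X Y : Graph S K,
    HasSum (fun p : Graph S K × Graph S K => entry ρ p.1 p.2 * entry (Φ p.1 p.2) X Y) (entry T X Y)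

open Classical in
/-- The value at `ρ` of the linear extension of `Φ`: the (unique) operator `T` with
`IsLinearExtension Φ ρ T`.  It is `0` if there is none. -/
def linearExtension (Φ : Graph S K → Graph S K → Op S K) (ρ : Op S K) : Op S K :=
  if h : ∃ T, IsLinearExtension Φ ρ T then h.choose else 0

/-! ### Partial trace and tensor -/

/-- `(|G⟩⟨H|)_{|χ} = |G_χ⟩⟨H_χ| ⟨H_χ̄|G_χ̄⟩`. -/
def partialTraceUnit (χ : Restriction S K) (G H : Graph S K) : Op S K :=
  inner ℂ (ket (χ.compl H)) (ket (χ.compl G)) • ketbra (ket (χ G)) (ket (χ H))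

/-- The generalized partial trace `ρ ↦ ρ_{|χ}`. -/
def partialTrace (χ : Restriction S K) (ρ : Op S K) : Op S K :=
  linearExtension (partialTraceUnit χ) ρ

open Classical in
/-- `|H⟩ ⊗_χ |H'⟩`: it is `|G⟩` if `H = G_χ` and `H' = G_χ̄` (such a `G` is unique, being
`H ∪ H'`), and `0` if there is no such `G`. -/
def tensorKet (χ : Restriction S K) (H H' : Graph S K) : HSpace S K :=
  if h : ∃ G, χ G = H ∧ χ.compl G = H' then ket h.choose else 0

/-- `|G⟩⟨H| ⊗_χ |G'⟩⟨H'|`. -/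
def tensorUnit (χ : Restriction S K) (G H G' H' : Graph S K) : Op S K :=
  ketbra (tensorKet χ G G') (tensorKet χ H H')

/-- The value of `(·)_{|χ} ⊗_ζ I` at `|G⟩⟨H| = |G_ζ⟩⟨H_ζ| ⊗_ζ |G_ζ̄⟩⟨H_ζ̄|`, that is
`(|G_ζ⟩⟨H_ζ|)_{|χ} ⊗_ζ |G_ζ̄⟩⟨H_ζ̄|`. -/
def traceTensorIdUnit (χ ζ : Restriction S K) (G H : Graph S K) : Op S K :=
  inner ℂ (ket (χ.compl (ζ H))) (ket (χ.compl (ζ G))) •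
    tensorUnit ζ (χ (ζ G)) (χ (ζ H)) (ζ.compl G) (ζ.compl H)

/-- The map `(·)_{|χ} ⊗_ζ I`. -/
def traceTensorId (χ ζ : Restriction S K) (ρ : Op S K) : Op S K :=
  linearExtension (traceTensorIdUnit χ ζ) ρ

/-- Positivity of an `n × n` matrix of operators, as an operator on the `n`-fold direct sum. -/
def BlockPositive {n : ℕ} (R : Fin n → Fin n → Op S K) : Prop :=
  ∀ x : Fin n → HSpace S K, 0 ≤ ∑ i, ∑ j, inner ℂ (x i) (R i j (x j))

end

end QNet

end

noncomputable section

namespace QNet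

/-! ### Cancellation in the name algebra -/

namespace Name

variable {C : Type*}

/-! Both maps are channels in Kraus form. Each splits `G` disjointly into a retained graph `out G`
(possibly undefined) and a discarded graph `env G`, and sends `ρ` to `∑_E K_E ρ K_E†`, where `K_E =
∑ |out G⟩⟨G|` over the `G` with `env G = E`. Since `G` is the union of its two parts, the pair
determines `G`, whence `∑_E ‖K_E x‖² ≤ ‖x‖²`. Cauchy–Schwarz over `E`, applied to `ρ = ∑ |aₙ⟩⟨bₙ|`,
then gives convergence and trace class (`exists_isTraceClass_hasSum`). Positivity and its matrix
version hold for each `E` separately. If `out` is total, regrouping the diagonal of `ρ` by `out G`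
preserves the trace.

Name preservation needs cancellation (`corresponds_of_union`): if `X ⊔ E` and `Y ⊔ E` generate the
same names, so do `X` and `Y`. Deep projections of a name from `X` are projections of vertices of
`Y` or `E`; well-namedness excludes `E`, and joining the projections recovers the name. -/

theorem left_join_right (u : Name C) : u.left.join u.right = u := by
  induction u using Quotient.inductionOn with
  | h u => exact Quotient.sound (NameEq.left_join_right u)

theorem join_left (u v : Name C) : (u.join v).left = u := by
  induction u, v using Quotient.inductionOn₂ with
  | h u v => exact Quotient.sound (NameEq.join_left u v)

theorem join_right (u v : Name C) : (u.join v).right = v := by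
  induction u, v using Quotient.inductionOn₂ with
  | h u v => exact Quotient.sound (NameEq.join_right u v)

theorem proj_cons_false (u : Name C) (t : List Bool) : u.proj (false :: t) = u.left.proj t := rfl

theorem proj_cons_true (u : Name C) (t : List Bool) : u.proj (true :: t) = u.right.proj t := rfl

theorem Generated.proj {V : Set (Name C)} {u : Name C} (h : Generated V u) (t : List Bool) :
    Generated V (u.proj t) := by
  induction t generalizing u with
  | nil => exact h
  | cons s t ih => cases s with
    | false => exact ih h.left
    | true => exact ih h.right

/-- A name all of whose projections at some depth are generated is itself generated. -/
theorem Generated.of_proj {V : Set (Name C)} {n : ℕ} {u : Name C}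
    (h : ∀ t : List Bool, t.length = n → Generated V (u.proj t)) : Generated V u := by
  induction n generalizing u with
  | zero => exact h [] rfl
  | succ n ih =>
    rw [← left_join_right u]
    exact .join (ih fun t ht => h (false :: t) (by simp [ht]))
      (ih fun t ht => h (true :: t) (by simp [ht]))

/-- Deep enough projections of a generated name are projections of generators. -/
theorem Generated.exists_proj_eq {V : Set (Name C)} {u : Name C} (h : Generated V u) :
    ∃ n, ∀ t : List Bool, n ≤ t.length → ∃ w ∈ V, ∃ s, u.proj t = w.proj s := by
  induction h with
  | of hu => exact ⟨0, fun t _ => ⟨_, hu, t, rfl⟩⟩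
  | left _ ih =>
    obtain ⟨n, hn⟩ := ih
    exact ⟨n, fun t ht => hn (false :: t) (by simp; omega)⟩
  | right _ ih =>
    obtain ⟨n, hn⟩ := ih
    exact ⟨n, fun t ht => hn (true :: t) (by simp; omega)⟩
  | @join u v _ _ ih ih' =>
    obtain ⟨n, hn⟩ := ih
    obtain ⟨m, hm⟩ := ih'
    refine ⟨max n m + 1, fun t ht => ?_⟩
    cases t with
    | nil => simp at ht
    | cons s t =>
      simp only [List.length_cons] at ht
      cases s with
      | false => rw [proj_cons_false, join_left]; exact hn t (by omega)
      | true => rw [proj_cons_true, join_right]; exact hm t (by omega)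

theorem Generated.trans {V W : Set (Name C)} (h : ∀ v ∈ V, Generated W v) {u : Name C}
    (hu : Generated V u) : Generated W u := by
  induction hu with
  | of hu => exact h _ hu
  | left _ ih => exact ih.left
  | right _ ih => exact ih.right
  | join _ _ ih ih' => exact ih.join ih'

/-- If no projection of `u` is a projection of an element of `E`, then `E` does not help to
generate `u`. -/
theorem Generated.of_union {V E : Set (Name C)} {u : Name C} (h : Generated (V ∪ E) u)
    (hE : ∀ w ∈ E, ∀ t s : List Bool, u.proj t ≠ w.proj s) : Generated V u := by
  obtain ⟨n, hn⟩ := h.exists_proj_eq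
  -- At depth `n` every projection of `u` comes from a single generator, which cannot lie in `E`.
  refine .of_proj (n := n) fun t ht => ?_
  obtain ⟨w, hw | hw, s, hs⟩ := hn t ht.ge
  · rw [hs]
    exact (Generated.of hw).proj s
  · exact absurd hs (hE w hw t s)

end Name

namespace Graph

variable {S K : Type*}

theorem support_eq_union {G X E : Graph S K} (h : X.systems ∪ E.systems = G.systems) :
    G.support = X.support ∪ E.support := by
  rw [support, ← h, Set.image_union]
  rfl

/-- One half of cancellation: well-namedness of `G` forbids a vertex of `X` and one of `E` to share
a projection, so `E` is useless for generating the names of `X`. -/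
theorem generated_of_corresponds {G H X Y E : Graph S K}
    (hG : X.systems ∪ E.systems = G.systems) (hd : Disjoint X.systems E.systems)
    (hH : Y.systems ∪ E.systems = H.systems)
    (h : Name.Corresponds G.support H.support) :
    ∀ v ∈ X.support, Name.Generated Y.support v := by
  rintro _ ⟨x, hx, rfl⟩
  have hxG : x ∈ G.systems := hG ▸ Or.inl hx
  have hx' : x.2 ∈ {u | Name.Generated H.support u} := by
    rw [← h]
    exact .of ⟨x, hxG, rfl⟩
  rw [support_eq_union hH] at hx'
  refine Name.Generated.of_union hx' ?_
  rintro _ ⟨y, hy, rfl⟩ t s hts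
  obtain ⟨rfl, -⟩ := G.wellNamed x hxG y (hG ▸ Or.inr hy) t s hts
  exact Set.disjoint_left.1 hd hx hy

/-- A common disjoint part can be cancelled from graphs whose supports generate the same names. -/
theorem corresponds_of_union {G H X Y E : Graph S K}
    (hG : X.systems ∪ E.systems = G.systems) (hGd : Disjoint X.systems E.systems)
    (hH : Y.systems ∪ E.systems = H.systems) (hHd : Disjoint Y.systems E.systems)
    (h : Name.Corresponds G.support H.support) : Name.Corresponds X.support Y.support := by
  ext u
  exact ⟨.trans (generated_of_corresponds hG hGd hH h),
    .trans (generated_of_corresponds hH hHd hG h.symm)⟩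

end Graph

/-! ### Kets, entries and trace class operators -/

section

variable {S K : Type*}

theorem inner_ket_left (G : Graph S K) (x : HSpace S K) : inner ℂ (ket G) x = x G := by
  classical
  simp only [ket]
  convert lp.inner_single_left (𝕜 := ℂ) G (1 : ℂ) x using 1
  simp

theorem inner_ket_right (G : Graph S K) (x : HSpace S K) :
    inner ℂ x (ket G) = star (x G) := by
  rw [← inner_conj_symm, inner_ket_left]
  rfl

open Classical in
theorem ket_apply (G H : Graph S K) : ket G H = if H = G then (1 : ℂ) else 0 := by
  simp only [ket, lp.single_apply, Pi.single_apply]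

open Classical in
theorem inner_ket_ket (G H : Graph S K) :
    inner ℂ (ket G) (ket H) = if G = H then (1 : ℂ) else 0 := by
  rw [inner_ket_left, ket_apply]

theorem hasSum_norm_sq (x : HSpace S K) : HasSum (fun G => ‖x G‖ ^ 2) (‖x‖ ^ 2) := by
  simpa using lp.hasSum_norm (p := 2) (by norm_num) x

theorem Op.ext_entry {T T' : Op S K} (h : ∀ G H, entry T G H = entry T' G H) : T = T' := by
  classical
  refine lp.ext_continuousLinearMap (by norm_num) fun H => ?_
  ext1
  refine lp.ext (funext fun G => ?_)
  have := h G H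
  rw [entry, entry, inner_ket_left, inner_ket_left] at this
  exact this

theorem inner_ketbra (a b x y : HSpace S K) :
    inner ℂ x (ketbra a b y) = inner ℂ x a * inner ℂ b y := by
  rw [ketbra, InnerProductSpace.rankOne_apply, inner_smul_right, mul_comm]

theorem norm_ketbra (a b : HSpace S K) : ‖ketbra a b‖ = ‖a‖ * ‖b‖ :=
  InnerProductSpace.norm_rankOne a b

theorem hasSum_inner_of_hasSum_ketbra {ι : Type*} {a b : ι → HSpace S K} {T : Op S K}
    (h : HasSum (fun i => ketbra (a i) (b i)) T) (x y : HSpace S K) :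
    HasSum (fun i => inner ℂ x (a i) * inner ℂ (b i) y) (inner ℂ x (T y)) := by
  have := (innerSL ℂ x).hasSum ((ContinuousLinearMap.apply ℂ (HSpace S K) y).hasSum h)
  simpa [inner_ketbra] using this

/-- An operator expanded along an arbitrary index type is trace class. -/
theorem isTraceClass_of_hasSum {ι : Type*} {a b : ι → HSpace S K} {T : Op S K}
    (hs : Summable fun i => ‖a i‖ * ‖b i‖) (h : HasSum (fun i => ketbra (a i) (b i)) T) :
    IsTraceClass T := by
  -- Summability leaves only countably many nonzero terms; these are injected into `ℕ` and padded
  -- with zero vectors.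
  set s := Function.support fun i => ‖a i‖ * ‖b i‖ with hs_def
  have : Countable s := hs.countable_support
  obtain ⟨f, hf⟩ := exists_injective_nat s
  refine ⟨Function.extend f (fun i => a i) 0, Function.extend f (fun i => b i) 0, ?_, ?_⟩
  · have h1 : (fun n => ‖Function.extend f (fun i : s => a i) 0 n‖ *
        ‖Function.extend f (fun i : s => b i) 0 n‖) =
        Function.extend f (fun i : s => ‖a i‖ * ‖b i‖) 0 := by
      funext n
      by_cases hn : ∃ i, f i = n
      · obtain ⟨i, rfl⟩ := hn
        simp only [hf.extend_apply]
      · simp [Function.extend_apply' _ _ _ hn]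
    rw [h1]
    exact ((hasSum_extend_zero hf).2 (hs.subtype s).hasSum).summable
  · have h1 : (fun n => ketbra (Function.extend f (fun i : s => a i) 0 n)
        (Function.extend f (fun i : s => b i) 0 n)) =
        Function.extend f (fun i : s => ketbra (a i) (b i)) 0 := by
      funext n
      by_cases hn : ∃ i, f i = n
      · obtain ⟨i, rfl⟩ := hn
        simp only [hf.extend_apply]
      · simp [Function.extend_apply' _ _ _ hn, ketbra]
    rw [h1, hasSum_extend_zero hf]
    refine (hasSum_subtype_iff_of_support_subset fun i hi => ?_).2 h
    simp only [Function.mem_support, hs_def] at hi ⊢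
    rwa [← norm_ketbra, norm_ne_zero_iff]

/-- Matrix entries determine a bounded operator, so the choice in the definition is immaterial. -/
theorem linearExtension_eq {Φ : Graph S K → Graph S K → Op S K} {ρ T : Op S K}
    (h : IsLinearExtension Φ ρ T) : linearExtension Φ ρ = T := by
  have hex : ∃ T, IsLinearExtension Φ ρ T := ⟨T, h⟩
  rw [linearExtension, dif_pos hex]
  exact Op.ext_entry fun X Y => (hex.choose_spec X Y).unique (h X Y)

/-- The Cauchy–Schwarz inequality for a product of square-summable families. -/
theorem summable_mul_and_tsum_mul_le {ι : Type*} {f g : ι → ℝ} {A B : ℝ} (hf : ∀ i, 0 ≤ f i)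
    (hg : ∀ i, 0 ≤ g i) (hA : 0 ≤ A) (hB : 0 ≤ B) (hfs : Summable fun i => f i ^ 2)
    (hgs : Summable fun i => g i ^ 2) (hfA : ∑' i, f i ^ 2 ≤ A ^ 2)
    (hgB : ∑' i, g i ^ 2 ≤ B ^ 2) :
    Summable (fun i => f i * g i) ∧ ∑' i, f i * g i ≤ A * B := by
  have hfs' : Summable fun i => f i ^ (2 : ℝ) := by simpa using hfs
  have hgs' : Summable fun i => g i ^ (2 : ℝ) := by simpa using hgs
  refine ⟨Real.summable_mul_of_Lp_Lq_of_nonneg Real.HolderConjugate.two_two hf hg hfs' hgs',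
    (Real.inner_le_Lp_mul_Lq_tsum_of_nonneg Real.HolderConjugate.two_two hf hg hfs' hgs').trans ?_⟩
  simp only [Real.rpow_ofNat, ← Real.sqrt_eq_rpow]
  exact mul_le_mul (Real.sqrt_le_iff.2 ⟨hA, hfA⟩) (Real.sqrt_le_iff.2 ⟨hB, hgB⟩)
    (Real.sqrt_nonneg _) hA

/-- Over `ℂ` a real quadratic form already forces symmetry, and `0 ≤` in the complex order includes
being real. -/
theorem isPositive_iff_inner_nonneg {T : Op S K} :
    T.IsPositive ↔ ∀ x, 0 ≤ inner ℂ x (T x) := by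
  refine ⟨fun h x => h.inner_nonneg_right x, fun h => ?_⟩
  rw [ContinuousLinearMap.isPositive_iff_complex]
  intro x
  have h1 : 0 ≤ inner ℂ (T x) x := by
    rw [← inner_conj_symm]
    exact star_nonneg_iff.2 (h x)
  obtain ⟨h2, h3⟩ := Complex.nonneg_iff.1 h1
  exact ⟨Complex.ext rfl h3, h2⟩

/-- Makes `trace` a genuine sum: Cauchy–Schwarz in the coordinates bounds the double series over `n`
and `G` by `∑ ‖aₙ‖ ‖bₙ‖`. -/
theorem summable_entry_self {ρ : Op S K} (hρ : IsTraceClass ρ) :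
    Summable fun G => entry ρ G G := by
  obtain ⟨a, b, hab, hρ⟩ := hρ
  have hcs (n : ℕ) := summable_mul_and_tsum_mul_le (f := fun G => ‖a n G‖)
    (g := fun G => ‖b n G‖) (fun _ => norm_nonneg _) (fun _ => norm_nonneg _)
    (norm_nonneg _) (norm_nonneg _) (hasSum_norm_sq (a n)).summable
    (hasSum_norm_sq (b n)).summable (hasSum_norm_sq (a n)).tsum_eq.le
    (hasSum_norm_sq (b n)).tsum_eq.le
  have hsum : Summable fun c : ℕ × Graph S K => ‖a c.1 c.2‖ * ‖b c.1 c.2‖ :=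
    (summable_prod_of_nonneg fun _ => by positivity).2 ⟨fun n => (hcs n).1,
      hab.of_nonneg_of_le (fun n => tsum_nonneg fun _ => by positivity) fun n => (hcs n).2⟩
  have hsum' : Summable fun c : ℕ × Graph S K => a c.1 c.2 * star (b c.1 c.2) :=
    .of_norm (by simpa using hsum)
  have h := hsum'.hasSum
  rw [← (Equiv.prodComm (Graph S K) ℕ).hasSum_iff] at h
  refine (h.prod_fiberwise fun G => ?_).summable
  have := hasSum_inner_of_hasSum_ketbra hρ (ket G) (ket G)
  simp only [inner_ket_left, inner_ket_right] at this
  rwa [← inner_ket_left] at this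

/-- Reading off the coordinates of a vector along a partial injection does not increase the sum
of squares. -/
theorem summable_and_tsum_elim_le {γ : Type*} {g : γ → Option (Graph S K)}
    (hg : ∀ c c' G, G ∈ g c → G ∈ g c' → c = c') (x : HSpace S K) :
    Summable (fun c => ‖(g c).elim 0 x‖ ^ 2) ∧ ∑' c, ‖(g c).elim 0 x‖ ^ 2 ≤ ‖x‖ ^ 2 := by
  let D : Set γ := {c | (g c).isSome}
  let i : D → Graph S K := fun c => (g c).get c.2
  have hi : Function.Injective i := fun c c' h =>
    Subtype.ext (hg c c' (i c) (by simp [i]) (by rw [h]; simp [i]))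
  have hx := hasSum_norm_sq x
  have hcomp : ((fun c => ‖(g c).elim 0 x‖ ^ 2) ∘ ((↑) : D → γ)) =
      (fun G => ‖x G‖ ^ 2) ∘ i := by
    funext c
    have : g c = some (i c) := by simp [i]
    simp [this]
  have hsupp : (Function.support fun c => ‖(g c).elim 0 x‖ ^ 2) ⊆ D := by
    intro c hc
    by_contra hcD
    have : g c = none := by simpa [D] using hcD
    simp [this] at hc
  have hsum := (hx.summable.comp_injective hi).hasSum
  rw [← hcomp, hasSum_subtype_iff_of_support_subset hsupp, hcomp] at hsum
  refine ⟨hsum.summable, ?_⟩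
  rw [hsum.tsum_eq, ← hx.tsum_eq]
  exact tsum_comp_le_tsum_of_inj hx.summable (fun _ => by positivity) hi

end

/-! ### Splittings and their Kraus operators -/

/-- A (partial) decomposition of graphs into a retained part `out G` and a discarded part
`env G`. -/
structure Splitting (S K : Type*) where
  out : Graph S K → Option (Graph S K)
  env : Graph S K → Graph S K
  union : ∀ G X, out G = some X → X.systems ∪ (env G).systems = G.systems
  disjoint : ∀ G X, out G = some X → Disjoint X.systems (env G).systems

namespace Splitting

variable {S K : Type*} (P : Splitting S K)

theorem eq_of_out_of_env {G H X : Graph S K} (hG : P.out G = some X) (hH : P.out H = some X)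
    (h : P.env G = P.env H) : G = H := by
  ext1
  rw [← P.union G X hG, ← P.union H X hH, h]

open Classical in
/-- The graph with discarded part `E` and retained part `X`, if there is one. -/
def glue (E X : Graph S K) : Option (Graph S K) :=
  if h : ∃ G, P.out G = some X ∧ P.env G = E then some h.choose else none

theorem mem_glue {E X G : Graph S K} :
    G ∈ P.glue E X ↔ P.out G = some X ∧ P.env G = E := by
  rw [glue]
  split_ifs with h
  · obtain ⟨h1, h2⟩ := h.choose_spec
    refine ⟨?_, fun hG => ?_⟩
    · rintro ⟨⟩
      exact ⟨h1, h2⟩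
    · exact congrArg some (P.eq_of_out_of_env h1 hG.1 (h2.trans hG.2.symm))
  · simpa using fun h1 h2 => h ⟨G, h1, h2⟩

theorem glue_injective {c c' : Graph S K × Graph S K} {G : Graph S K}
    (h : G ∈ P.glue c.1 c.2) (h' : G ∈ P.glue c'.1 c'.2) : c = c' := by
  rw [mem_glue] at h h'
  exact Prod.ext (h.2.symm.trans h'.2) (Option.some.inj (h.1.symm.trans h'.1))

theorem glue_injective_right {E X X' G : Graph S K} (h : G ∈ P.glue E X)
    (h' : G ∈ P.glue E X') : X = X' :=
  congrArg Prod.snd (P.glue_injective (c := (E, X)) (c' := (E, X')) h h')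

theorem memℓp_glue (E : Graph S K) (x : HSpace S K) :
    Memℓp (fun X => (P.glue E X).elim (0 : ℂ) x) 2 := by
  rw [memℓp_gen_iff (by norm_num)]
  simpa using (summable_and_tsum_elim_le (fun _ _ _ => P.glue_injective_right) x).1

/-- The Kraus operator `∑ |out G⟩⟨G|`, the sum being over the graphs `G` with discarded
part `E`. -/
def kraus (E : Graph S K) : Op S K :=
  LinearMap.mkContinuous
    { toFun := fun x => ⟨fun X => (P.glue E X).elim 0 x, P.memℓp_glue E x⟩
      map_add' := fun x y => lp.ext <| funext fun X => by
        change (P.glue E X).elim 0 (x + y) = (P.glue E X).elim 0 x + (P.glue E X).elim 0 y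
        cases P.glue E X
        exacts [(add_zero _).symm, rfl]
      map_smul' := fun r x => lp.ext <| funext fun X => by
        change (P.glue E X).elim 0 (r • x) = r • (P.glue E X).elim 0 x
        cases P.glue E X <;> simp } 1 fun x => by
    rw [one_mul]
    refine (sq_le_sq₀ (norm_nonneg _) (norm_nonneg _)).1 ?_
    rw [← (hasSum_norm_sq _).tsum_eq]
    exact (summable_and_tsum_elim_le (fun _ _ _ => P.glue_injective_right) x).2

theorem kraus_apply (E X : Graph S K) (x : HSpace S K) :
    P.kraus E x X = (P.glue E X).elim 0 x := rfl

/-- This is `∑_E K_E† K_E ≤ 1`: over all pairs `(E, X)`, each coordinate of `x` is read at most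
once. -/
theorem summable_and_tsum_norm_kraus_sq_le (x : HSpace S K) :
    Summable (fun E => ‖P.kraus E x‖ ^ 2) ∧ ∑' E, ‖P.kraus E x‖ ^ 2 ≤ ‖x‖ ^ 2 := by
  obtain ⟨h1, h2⟩ := summable_and_tsum_elim_le
    (g := fun c : Graph S K × Graph S K => P.glue c.1 c.2)
    (fun c c' G h h' => P.glue_injective h h') x
  have h3 : HasSum (fun E => ‖P.kraus E x‖ ^ 2)
      (∑' c : Graph S K × Graph S K, ‖(P.glue c.1 c.2).elim 0 x‖ ^ 2) :=
    h1.hasSum.prod_fiberwise fun E => hasSum_norm_sq (P.kraus E x)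
  exact ⟨h3.summable, h3.tsum_eq.trans_le h2⟩

/-- Turns each Kraus term of an entry of the channel into a single entry of `ρ`, or zero. -/
theorem adjoint_kraus_ket (E X : Graph S K) :
    (P.kraus E).adjoint (ket X) = (P.glue E X).elim 0 ket := by
  refine lp.ext (funext fun G => ?_)
  rw [← inner_ket_left, ContinuousLinearMap.adjoint_inner_right, inner_ket_right, kraus_apply]
  cases h : P.glue E X with
  | none => simp
  | some H =>
    classical
    simp only [Option.elim_some, ket_apply, eq_comm]
    split_ifs <;> simp

/-- The quadratic form of the image of a trace class operator under the channel with Kraus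
operators `P.kraus E`. -/
theorem exists_isTraceClass_hasSum {ρ : Op S K} (hρ : IsTraceClass ρ) :
    ∃ T : Op S K, IsTraceClass T ∧ ∀ x y : HSpace S K,
      HasSum (fun E => inner ℂ ((P.kraus E).adjoint x) (ρ ((P.kraus E).adjoint y)))
        (inner ℂ x (T y)) := by
  obtain ⟨a, b, hab, hρ⟩ := hρ
  have hcs (n : ℕ) := summable_mul_and_tsum_mul_le (f := fun E => ‖P.kraus E (a n)‖)
    (g := fun E => ‖P.kraus E (b n)‖) (fun _ => norm_nonneg _) (fun _ => norm_nonneg _)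
    (norm_nonneg _) (norm_nonneg _) (P.summable_and_tsum_norm_kraus_sq_le (a n)).1
    (P.summable_and_tsum_norm_kraus_sq_le (b n)).1
    (P.summable_and_tsum_norm_kraus_sq_le (a n)).2
    (P.summable_and_tsum_norm_kraus_sq_le (b n)).2
  have hsum : Summable fun c : ℕ × Graph S K =>
      ‖P.kraus c.2 (a c.1)‖ * ‖P.kraus c.2 (b c.1)‖ :=
    (summable_prod_of_nonneg fun _ => by positivity).2 ⟨fun n => (hcs n).1,
      hab.of_nonneg_of_le (fun n => tsum_nonneg fun _ => by positivity) fun n => (hcs n).2⟩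
  have hT : Summable fun c : ℕ × Graph S K =>
      ketbra (P.kraus c.2 (a c.1)) (P.kraus c.2 (b c.1)) :=
    .of_norm (by simpa only [norm_ketbra] using hsum)
  refine ⟨_, isTraceClass_of_hasSum hsum hT.hasSum, fun x y => ?_⟩
  have h := hasSum_inner_of_hasSum_ketbra hT.hasSum x y
  -- With `E` as the outer index, the inner sum over `n` reassembles `ρ`.
  rw [← (Equiv.prodComm (Graph S K) ℕ).hasSum_iff] at h
  refine h.prod_fiberwise fun E => ?_
  have := hasSum_inner_of_hasSum_ketbra hρ ((P.kraus E).adjoint x) ((P.kraus E).adjoint y)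
  simpa [ContinuousLinearMap.adjoint_inner_left, ContinuousLinearMap.adjoint_inner_right]
    using this

/-- The image of a trace class operator under the channel with Kraus operators `P.kraus E`. -/
def channel {ρ : Op S K} (hρ : IsTraceClass ρ) : Op S K :=
  (P.exists_isTraceClass_hasSum hρ).choose

variable {ρ : Op S K} (hρ : IsTraceClass ρ)

theorem isTraceClass_channel : IsTraceClass (P.channel hρ) :=
  (P.exists_isTraceClass_hasSum hρ).choose_spec.1

theorem hasSum_inner_channel (x y : HSpace S K) :
    HasSum (fun E => inner ℂ ((P.kraus E).adjoint x) (ρ ((P.kraus E).adjoint y)))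
      (inner ℂ x (P.channel hρ y)) :=
  (P.exists_isTraceClass_hasSum hρ).choose_spec.2 x y

/-- The matrix units that define the channel. -/
def unit (G H : Graph S K) : Op S K :=
  inner ℂ (ket (P.env H)) (ket (P.env G)) •
    ketbra ((P.out G).elim 0 ket) ((P.out H).elim 0 ket)

open Classical in
theorem entry_unit (G H X Y : Graph S K) :
    entry (P.unit G H) X Y =
      if P.env G = P.env H ∧ P.out G = some X ∧ P.out H = some Y then 1 else 0 := by
  rw [entry, unit, smul_apply, inner_smul_right, inner_ketbra, inner_ket_ket]
  cases hG : P.out G <;> cases hH : P.out H <;> simp [inner_ket_ket, eq_comm, ← ite_and, and_comm]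

/-- For fixed `X`, `Y`, a pair `(G, H)` contributes only if both graphs have the same discarded part
`E`; then `G = E ∪ X` and `H = E ∪ Y`. The double sum is thus the Kraus sum over `E`. -/
theorem isLinearExtension_channel : IsLinearExtension P.unit ρ (P.channel hρ) := by
  classical
  intro X Y
  have h := P.hasSum_inner_channel hρ (ket X) (ket Y)
  simp only [adjoint_kraus_ket] at h
  refine (hasSum_iff_hasSum_of_ne_zero_bij (fun p => P.env p.1.1) ?_ ?_ ?_).1 h
  · rintro ⟨⟨G, H⟩, hp⟩ ⟨⟨G', H'⟩, hp'⟩ he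
    simp only [entry_unit, Function.mem_support, ne_eq, mul_ite, mul_one, mul_zero,
      ite_eq_right_iff, not_forall] at hp hp' he
    obtain ⟨⟨h1, h2, h3⟩, -⟩ := hp
    obtain ⟨⟨h1', h2', h3'⟩, -⟩ := hp'
    simp only [Subtype.mk.injEq, Prod.mk.injEq]
    exact ⟨P.eq_of_out_of_env h2 h2' he, P.eq_of_out_of_env h3 h3' (h1 ▸ h1' ▸ he)⟩
  · intro E hE
    cases hX : P.glue E X with
    | none => simp [hX] at hE
    | some G =>
      cases hY : P.glue E Y with
      | none => simp [hY] at hE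
      | some H =>
        obtain ⟨h1, h2⟩ := P.mem_glue.1 (Option.mem_def.2 hX)
        obtain ⟨h3, h4⟩ := P.mem_glue.1 (Option.mem_def.2 hY)
        refine ⟨⟨(G, H), ?_⟩, h2⟩
        rw [Function.mem_support, entry_unit, if_pos ⟨h2.trans h4.symm, h1, h3⟩, mul_one]
        simpa [hX, hY, entry] using hE
  · rintro ⟨⟨G, H⟩, hp⟩
    simp only [entry_unit, Function.mem_support, ne_eq, mul_ite, mul_one, mul_zero,
      ite_eq_right_iff, not_forall] at hp
    obtain ⟨⟨h1, h2, h3⟩, -⟩ := hp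
    have hX : P.glue (P.env G) X = some G := P.mem_glue.2 ⟨h2, rfl⟩
    have hY : P.glue (P.env G) Y = some H := P.mem_glue.2 ⟨h3, h1.symm⟩
    simp only [hX, hY, Option.elim_some]
    rw [entry_unit, if_pos ⟨h1, h2, h3⟩, mul_one, entry]

theorem linearExtension_unit : linearExtension P.unit ρ = P.channel hρ :=
  linearExtension_eq (P.isLinearExtension_channel hρ)

/-- For each `E` the summand is the quadratic form of `R` at the vectors `K_E† xᵢ`. -/
theorem blockPositive_channel {n : ℕ} {R : Fin n → Fin n → Op S K}
    (hR : ∀ i j, IsTraceClass (R i j)) (h : BlockPositive R) :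
    BlockPositive fun i j => P.channel (hR i j) := fun x =>
  (hasSum_sum fun i _ => hasSum_sum fun j _ =>
    P.hasSum_inner_channel (hR i j) (x i) (x j)).nonneg fun E =>
      h fun i => (P.kraus E).adjoint (x i)

theorem isPositive_channel (h : ρ.IsPositive) : (P.channel hρ).IsPositive := by
  rw [isPositive_iff_inner_nonneg] at h ⊢
  exact fun x => (P.hasSum_inner_channel hρ x x).nonneg fun E => h _

/-- Every contributing entry of `ρ` joins two graphs with a common discarded part; cancelling it
shows that this entry vanishes unless the retained parts correspond. -/
theorem namePreserving_channel (h : NamePreserving ρ) : NamePreserving (P.channel hρ) := by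
  classical
  intro Y X hXY
  refine (P.isLinearExtension_channel hρ X Y).unique ?_
  convert hasSum_zero with p
  rw [entry_unit]
  split_ifs with hp
  · obtain ⟨he, hX, hY⟩ := hp
    rw [h, zero_mul]
    exact fun hc => hXY (Graph.corresponds_of_union (he ▸ P.union _ _ hY)
      (he ▸ P.disjoint _ _ hY) (P.union _ _ hX) (P.disjoint _ _ hX) hc)
  · rw [mul_zero]

theorem trace_channel (hP : ∀ G, (P.out G).isSome) : trace (P.channel hρ) = trace ρ := by
  have h := (summable_entry_self hρ).hasSum
  have h' : HasSum (fun c : Graph S K × Graph S K =>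
      inner ℂ ((P.glue c.2 c.1).elim 0 ket) (ρ ((P.glue c.2 c.1).elim 0 ket))) (trace ρ) := by
    have hmem (G : Graph S K) : P.glue (P.env G) ((P.out G).get (hP G)) = some G :=
      P.mem_glue.2 ⟨by simp, rfl⟩
    -- Totality of `out` puts every diagonal entry of `ρ` at exactly one pair `(X, E)`; the
    -- remaining pairs contribute zero.
    rw [← Function.Injective.hasSum_iff (g := fun G => ((P.out G).get (hP G), P.env G))]
    · simpa [Function.comp_def, hmem, entry, trace] using h
    · intro G H hGH
      obtain ⟨h1, h2⟩ := Prod.ext_iff.1 hGH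
      have := hmem G
      simp only at h1 h2
      rw [h1, h2, hmem] at this
      exact (Option.some.inj this).symm
    · rintro ⟨X, E⟩ hc
      cases hg : P.glue E X with
      | none => simp
      | some G =>
        obtain ⟨h1, h2⟩ := P.mem_glue.1 (Option.mem_def.2 hg)
        exact absurd ⟨G, by simp [h1, h2]⟩ hc
  refine (h'.prod_fiberwise fun X => ?_).tsum_eq
  have := P.hasSum_inner_channel hρ (ket X) (ket X)
  simpa only [adjoint_kraus_ket, entry] using this

end Splitting

/-! ### The splittings of partial traces -/

section

variable {S K : Type*}

theorem Restriction.systems_subset (χ : Restriction S K) (G : Graph S K) :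
    (χ G).systems ⊆ G.systems := χ.subset G

theorem Restriction.union_compl (χ : Restriction S K) (G : Graph S K) :
    (χ G).systems ∪ (χ.compl G).systems = G.systems :=
  Set.union_sdiff_cancel (χ.systems_subset G)

/-- The splitting of `G` into `χ G` and its complement. -/
def Restriction.splitting (χ : Restriction S K) : Splitting S K where
  out G := some (χ G)
  env := χ.compl
  union := by
    rintro G _ ⟨⟩
    exact χ.union_compl G
  disjoint := by
    rintro G _ ⟨⟩
    exact Set.disjoint_sdiff_right

theorem Restriction.unit_splitting (χ : Restriction S K) :
    χ.splitting.unit = partialTraceUnit χ := rfl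

open Classical in
/-- The splitting of `G` that discards the complement of `χ (ζ G)` in `ζ G`. -/
def Restriction.tensorSplitting (χ ζ : Restriction S K) : Splitting S K where
  out G := if h : ∃ X, ζ X = χ (ζ G) ∧ ζ.compl X = ζ.compl G then some h.choose else none
  env G := χ.compl (ζ G)
  union := by
    intro G X hX
    split_ifs at hX with h
    obtain ⟨h1, h2⟩ := h.choose_spec
    rw [Option.some.inj hX] at h1 h2
    -- Regroup `(G_ζχ ∪ G_ζ̄) ∪ G_ζχ̄` so that the two parts of `G_ζ` meet.
    rw [← ζ.union_compl X, h1, h2, Set.union_right_comm, χ.union_compl, ζ.union_compl]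
  disjoint := by
    intro G X hX
    split_ifs at hX with h
    obtain ⟨h1, h2⟩ := h.choose_spec
    rw [Option.some.inj hX] at h1 h2
    rw [← ζ.union_compl X, h1, h2, Set.disjoint_union_left]
    exact ⟨Set.disjoint_sdiff_right,
      Set.disjoint_sdiff_left.mono_right Set.sdiff_subset⟩

/-- Both sides choose from the same existential, so `none` matches the zero tensor and the chosen
graphs agree definitionally. -/
theorem Restriction.tensorSplitting_out_elim (χ ζ : Restriction S K) (G : Graph S K) :
    ((χ.tensorSplitting ζ).out G).elim 0 ket = tensorKet ζ (χ (ζ G)) (ζ.compl G) := by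
  simp only [tensorSplitting, tensorKet]
  split_ifs <;> rfl

theorem Restriction.unit_tensorSplitting (χ ζ : Restriction S K) :
    (χ.tensorSplitting ζ).unit = traceTensorIdUnit χ ζ := by
  funext G H
  rw [Splitting.unit, tensorSplitting_out_elim, tensorSplitting_out_elim]
  rfl

theorem Restriction.tensorSplitting_out_isSome (χ ζ : Restriction S K) {G : Graph S K}
    (h : tensorKet ζ (χ (ζ G)) (ζ.compl G) ≠ 0) : ((χ.tensorSplitting ζ).out G).isSome := by
  rw [← tensorSplitting_out_elim] at h
  cases hG : (χ.tensorSplitting ζ).out G with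
  | none => simp [hG] at h
  | some X => rfl

theorem traceTensorId_eq (χ ζ : Restriction S K) {ρ : Op S K} (hρ : IsTraceClass ρ) :
    traceTensorId χ ζ ρ = (χ.tensorSplitting ζ).channel hρ := by
  rw [traceTensorId, ← χ.unit_tensorSplitting, Splitting.linearExtension_unit]

theorem partialTrace_eq (χ : Restriction S K) {ρ : Op S K} (hρ : IsTraceClass ρ) :
    partialTrace χ ρ = χ.splitting.channel hρ := by
  rw [partialTrace, ← χ.unit_splitting, Splitting.linearExtension_unit]

end

end QNet

end

theorem mainTheorem4 {S K : Type*} (χ : QNet.Restriction S K) :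
    -- the map `(·)_{|χ} ⊗_ζ I` on trace class operators, for every restriction `ζ`
    (∀ ζ : QNet.Restriction S K,
      (∀ ρ : QNet.Op S K, QNet.IsTraceClass ρ →
        QNet.IsLinearExtension (QNet.traceTensorIdUnit χ ζ) ρ (QNet.traceTensorId χ ζ ρ) ∧
        QNet.IsTraceClass (QNet.traceTensorId χ ζ ρ) ∧
        (ρ.IsPositive → (QNet.traceTensorId χ ζ ρ).IsPositive) ∧
        (QNet.NamePreserving ρ → QNet.NamePreserving (QNet.traceTensorId χ ζ ρ))) ∧
      ((∀ G : QNet.Graph S K, QNet.tensorKet ζ (χ (ζ G)) (ζ.compl G) ≠ 0) →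
        ∀ ρ : QNet.Op S K, QNet.IsTraceClass ρ →
          QNet.trace (QNet.traceTensorId χ ζ ρ) = QNet.trace ρ)) ∧
    -- the generalized partial trace itself
    (∀ ρ : QNet.Op S K, QNet.IsTraceClass ρ →
      QNet.IsLinearExtension (QNet.partialTraceUnit χ) ρ (QNet.partialTrace χ ρ) ∧
      QNet.IsTraceClass (QNet.partialTrace χ ρ) ∧
      (ρ.IsPositive → (QNet.partialTrace χ ρ).IsPositive) ∧
      (QNet.NamePreserving ρ → QNet.NamePreserving (QNet.partialTrace χ ρ)) ∧
      QNet.trace (QNet.partialTrace χ ρ) = QNet.trace ρ) ∧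
    -- its matrix amplifications
    (∀ (n : ℕ) (R : Fin n → Fin n → QNet.Op S K), (∀ i j, QNet.IsTraceClass (R i j)) →
      QNet.BlockPositive R → QNet.BlockPositive fun i j => QNet.partialTrace χ (R i j)) := by
  refine ⟨fun ζ => ⟨fun ρ hρ => ?_, fun hne ρ hρ => ?_⟩, fun ρ hρ => ?_, fun n R hR h => ?_⟩
  · rw [QNet.traceTensorId_eq χ ζ hρ, ← χ.unit_tensorSplitting]
    exact ⟨QNet.Splitting.isLinearExtension_channel _ hρ,
      QNet.Splitting.isTraceClass_channel _ hρ, QNet.Splitting.isPositive_channel _ hρ,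
      QNet.Splitting.namePreserving_channel _ hρ⟩
  · rw [QNet.traceTensorId_eq χ ζ hρ]
    exact QNet.Splitting.trace_channel _ hρ fun G => χ.tensorSplitting_out_isSome ζ (hne G)
  · rw [QNet.partialTrace_eq χ hρ, ← χ.unit_splitting]
    exact ⟨QNet.Splitting.isLinearExtension_channel _ hρ,
      QNet.Splitting.isTraceClass_channel _ hρ, QNet.Splitting.isPositive_channel _ hρ,
      QNet.Splitting.namePreserving_channel _ hρ,
      QNet.Splitting.trace_channel _ hρ fun _ => rfl⟩
  · simp only [fun i j => QNet.partialTrace_eq χ (hR i j)]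
    exact QNet.Splitting.blockPositive_channel _ hR h
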